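/- Let $k,q,l\ge 0$ be integers and let $V:\mathbb R^l\to\mathbb R^{k\times k}$ be identifiable, i.e. $V(\theta_1)=V(\theta_2)$ implies $\theta_1=\theta_2$ whenever $V(\theta_1),V(\theta_2)$ are positive definite symmetric. Let $\rho:\mathbb R\to\mathbb R$ satisfy (R1) $\rho$ is symmetric around zero, $\rho(0)=0$, and $\rho$ is continuous at $0$; (R2) there is a finite $c_0>0$ such that $\rho$ is non-decreasing on $[0,c_0]$ and constant on $[c_0,\infty)$. Let $h:[0,\infty)\to[0,\infty)$ be non-increasing, such that for each $\mu\in\mathbb R^k$ and each positive definite symmetric $\Sigma\in\mathbb R^{k\times k}$ $$f_{\mu,\Sigma}(y)=\det(\Sigma)^{-1/2}\,h\big((y-\mu)^T\Sigma^{-1}(y-\mu)\big)$$ is a probability density on $\mathbb R^k$ (equivalently, $\int h(\|z\|^2)\,dz=1$). Suppose that $h$ and $t\mapsto-\rho(\sqrt t)$ have a common point of decrease, where $s>0$ is a point of decrease of $g$ if $g(b)<g(a)$ for all $0\le a<s<b$. Put $b_0=\int\rho(\|z\|)\,f_{0,I_k}(z)\,dz$. For a probability measure $P$ on pairs $(y,X)\in\mathbb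 R^k\times\mathbb R^{k\times q}$, consider the S-minimization problem $$\min_{\beta,\theta}\ \det V(\theta)\quad\text{subject to}\quad \int\rho\Big(\sqrt{(y-X\beta)^TV(\theta)^{-1}(y-X\beta)}\Big)\,dP(y,X)\le b_0,$$ where the minimum is taken over all $\beta\in\mathbb R^q$ and $\theta\in\mathbb R^l$ such that $V(\theta)$ is positive definite symmetric. Let $\beta_0\in\mathbb R^q$ and $\theta_0\in\mathbb R^l$ with $V(\theta_0)$ positive definite symmetric. (a) If $X$ is a fixed $k\times q$ matrix with $X^TX$ non-singular and $y$ has density $f_{X\beta_0,V(\theta_0)}$, then the problem with constraint $\int\rho\big(\sqrt{(y-X\beta)^TV(\theta)^{-1}(y-X\beta)}\big)f_{X\beta_0,V(\theta_0)}(y)\,dy\le b_0$ has the unique solution $(\beta_0,\theta_0)$. (b) If $(y,X)$ has distribution $P$, the conditional distribution of $y$ given $X$ has density $f_{X\beta_0,V(\theta_0)}$ for almost every $X$, and there is no $\gamma\ne0$ with $X\gamma=0$ almost surely (for instance if $X$ has full column rank with probability one), then the problem at $P$ has the unique solution $(\beta_0,\theta_0)$; that is, the S-functional is Fisher consistent at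 $P$. -/

import Mathlib

open MeasureTheory ProbabilityTheory Matrix

noncomputable section

/-- Matrices carry the product (Borel) σ-algebra of `ℝ^{k × q}`. -/
instance instMeasurableSpaceRealMatrix {k q : ℕ} : MeasurableSpace (Matrix (Fin k) (Fin q) ℝ) :=
  inferInstanceAs (MeasurableSpace (Fin k → Fin q → ℝ))

instance instBorelSpaceRealMatrix {k q : ℕ} : BorelSpace (Matrix (Fin k) (Fin q) ℝ) :=
  inferInstanceAs (BorelSpace (Fin k → Fin q → ℝ))

/-- The quadratic form `(y - μ)ᵀ Σ⁻¹ (y - μ)`. -/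
def quadForm {k : ℕ} (y μ : Fin k → ℝ) (S : Matrix (Fin k) (Fin k) ℝ) : ℝ :=
  (y - μ) ⬝ᵥ (S⁻¹ *ᵥ (y - μ))

/-- The Mahalanobis distance `√((y - Xβ)ᵀ V⁻¹ (y - Xβ))` of a point `s = (y, X)`. -/
def mahalanobis {k q : ℕ} (s : (Fin k → ℝ) × Matrix (Fin k) (Fin q) ℝ) (β : Fin q → ℝ)
    (V : Matrix (Fin k) (Fin k) ℝ) : ℝ :=
  Real.sqrt (quadForm s.1 (s.2 *ᵥ β) V)

/-- Condition (R1): `ρ` is symmetric around zero, `ρ 0 = 0`, and `ρ` is continuous at zero. -/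
structure RhoR1 (ρ : ℝ → ℝ) : Prop where
  symm : ∀ s, ρ (-s) = ρ s
  zero : ρ 0 = 0
  continuousAt_zero : ContinuousAt ρ 0

/-- Condition (R2): there is a finite `c₀ > 0` such that `ρ` is non-decreasing on `[0, c₀]` and
constant on `[c₀, ∞)`. -/
def RhoR2 (ρ : ℝ → ℝ) : Prop :=
  ∃ c₀ : ℝ, 0 < c₀ ∧ MonotoneOn ρ (Set.Icc 0 c₀) ∧ ∀ s, c₀ ≤ s → ρ s = ρ c₀

/-- `s > 0` is a point of decrease of a function `g` on `[0, ∞)`: `g b < g a` whenever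
`0 ≤ a < s < b`. -/
def IsPointOfDecrease (g : ℝ → ℝ) (s : ℝ) : Prop :=
  0 < s ∧ ∀ a b, 0 ≤ a → a < s → s < b → g b < g a

/-- The elliptically contoured density
`f_{μ,Σ}(y) = det(Σ)^{-1/2} h((y - μ)ᵀ Σ⁻¹ (y - μ))` with generator `h`. -/
def ellipticalDensity {k : ℕ} (h : ℝ → ℝ) (μ : Fin k → ℝ) (S : Matrix (Fin k) (Fin k) ℝ)
    (y : Fin k → ℝ) : ℝ :=
  (Real.sqrt S.det)⁻¹ * h (quadForm y μ S)

/-- The distribution on `ℝᵏ` with Lebesgue density `f_{μ,Σ}`. -/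
def ellipticalMeasure {k : ℕ} (h : ℝ → ℝ) (μ : Fin k → ℝ) (S : Matrix (Fin k) (Fin k) ℝ) :
    Measure (Fin k → ℝ) :=
  volume.withDensity fun y => ENNReal.ofReal (ellipticalDensity h μ S y)

/-- The covariance structure `V` is identifiable: on the parameters `θ` with `V(θ)` positive
definite, `V(θ₁) = V(θ₂)` implies `θ₁ = θ₂`. -/
def Identifiable {k l : ℕ} (V : (Fin l → ℝ) → Matrix (Fin k) (Fin k) ℝ) : Prop :=
  ∀ θ₁ θ₂, (V θ₁).PosDef → (V θ₂).PosDef → V θ₁ = V θ₂ → θ₁ = θ₂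

/-- The pair `(β, θ)` is admissible for the S-minimization problem at `P`: `V(θ)` is a positive
definite symmetric matrix and `∫ ρ(√((y - Xβ)ᵀ V(θ)⁻¹ (y - Xβ))) dP(y, X) ≤ b₀`. -/
def SFeasible {k q l : ℕ} (ρ : ℝ → ℝ) (b₀ : ℝ) (V : (Fin l → ℝ) → Matrix (Fin k) (Fin k) ℝ)
    (P : Measure ((Fin k → ℝ) × Matrix (Fin k) (Fin q) ℝ))
    (β : Fin q → ℝ) (θ : Fin l → ℝ) : Prop :=
  (V θ).PosDef ∧ ∫ s, ρ (mahalanobis s β (V θ)) ∂P ≤ b₀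

/-- The pair `(β, θ)` solves the S-minimization problem at `P`: it minimizes `det V(θ)` over all
admissible pairs. -/
def IsSSolution {k q l : ℕ} (ρ : ℝ → ℝ) (b₀ : ℝ) (V : (Fin l → ℝ) → Matrix (Fin k) (Fin k) ℝ)
    (P : Measure ((Fin k → ℝ) × Matrix (Fin k) (Fin q) ℝ))
    (β : Fin q → ℝ) (θ : Fin l → ℝ) : Prop :=
  SFeasible ρ b₀ V P β θ ∧
    ∀ β' θ', SFeasible ρ b₀ V P β' θ' → (V θ).det ≤ (V θ').det

end

/-! Everything reduces to one strict inequality (`integral_rho_lt`): if `S.det ≤ S₀.det` and `(μ, S)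
≠ (μ₀, S₀)`, then under `f_{μ₀,S₀}` the expected loss at `(μ, S)` exceeds the one at `(μ₀, S₀)`,
which is `b₀` by affine invariance. So no other location and scatter of at most the same determinant
is feasible.

With `C` the maximum of `ρ`, write `C - ρ ∘ √` as an integral of indicators of its superlevel sets,
which are bounded-above lower sets `D`. For each `D`, the ellipsoid `{quadForm y μ₀ S₀ ∈ D}` is a
level set of the density, so it carries at least the mass of any ellipsoid of no larger volume
(`ellipticalMeasure_quadForm_preimage_le`, a bathtub argument). Around a common point of decrease
the gain is strict for an interval of levels, because two distinct ellipsoids of equal volume cannot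
be nested (`eq_of_quadForm_sublevel_subset`). For random `X`, the inequality is integrated over the
conditional laws of `y`. -/

open scoped MatrixOrder ComplexOrder in
theorem Matrix.PosDef.exists_eq_mul_transpose {k : ℕ} {S : Matrix (Fin k) (Fin k) ℝ}
    (hS : S.PosDef) : ∃ B : Matrix (Fin k) (Fin k) ℝ, B.det ≠ 0 ∧ S = B * Bᵀ := by
  have h := hS.posSemidef.nonneg
  obtain ⟨C, hC⟩ := CStarAlgebra.nonneg_iff_eq_star_mul_self.mp h
  refine ⟨Cᵀ, ?_, ?_⟩
  · have := hS.det_pos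
    rw [hC, det_mul] at this
    rw [det_transpose]
    exact right_ne_zero_of_mul this.ne'
  · rw [hC, transpose_transpose, star_eq_conjTranspose, conjTranspose_eq_transpose_of_trivial]

theorem quadForm_nonneg {k : ℕ} {S : Matrix (Fin k) (Fin k) ℝ} (hS : S.PosDef)
    (y μ : Fin k → ℝ) : 0 ≤ quadForm y μ S := by
  simpa [quadForm] using hS.inv.posSemidef.dotProduct_mulVec_nonneg (y - μ)

theorem continuous_quadForm {k : ℕ} (μ : Fin k → ℝ) (S : Matrix (Fin k) (Fin k) ℝ) :
    Continuous fun y => quadForm y μ S := by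
  unfold quadForm
  fun_prop

/-- The quadratic form in coordinates adapted to a reference ellipsoid. -/
theorem quadForm_mulVec_add {k : ℕ} (B S : Matrix (Fin k) (Fin k) ℝ) (w m μ : Fin k → ℝ) :
    quadForm (B *ᵥ w + μ) (B *ᵥ m + μ) S = (w - m) ⬝ᵥ ((Bᵀ * S⁻¹ * B) *ᵥ (w - m)) := by
  have : B *ᵥ w + μ - (B *ᵥ m + μ) = B *ᵥ (w - m) := by rw [mulVec_sub]; abel
  rw [quadForm, this, ← mulVec_mulVec, ← mulVec_mulVec, dotProduct_mulVec _ Bᵀ, vecMul_transpose]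

theorem transpose_mul_inv_mul_cancel {k : ℕ} {B : Matrix (Fin k) (Fin k) ℝ} (hB : B.det ≠ 0) :
    Bᵀ * (B * Bᵀ)⁻¹ * B = 1 := by
  have h1 : IsUnit B.det := hB.isUnit
  have h2 : IsUnit Bᵀ.det := by rwa [det_transpose]
  rw [Matrix.mul_inv_rev, ← Matrix.mul_assoc, mul_nonsing_inv _ h2, Matrix.one_mul, nonsing_inv_mul _ h1]

theorem quadForm_mulVec_add_self {k : ℕ} {B : Matrix (Fin k) (Fin k) ℝ} (hB : B.det ≠ 0)
    (w μ : Fin k → ℝ) : quadForm (B *ᵥ w + μ) μ (B * Bᵀ) = w ⬝ᵥ w := by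
  have := quadForm_mulVec_add B (B * Bᵀ) w 0 μ
  simpa [transpose_mul_inv_mul_cancel hB] using this

theorem quadForm_zero_one {k : ℕ} (z : Fin k → ℝ) : quadForm z 0 1 = z ⬝ᵥ z := by
  simp [quadForm]

/-! ### Rigidity of nested ellipsoids -/

/-- A unit ball contained in an ellipsoid of no larger volume coincides with it. -/
theorem Matrix.PosDef.eq_one_of_ball_subset {k : ℕ} {A : Matrix (Fin k) (Fin k) ℝ}
    (hA : A.PosDef) (hdet : 1 ≤ A.det) (m : Fin k → ℝ) {s : ℝ} (hs : 0 < s)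
    (h : ∀ w : Fin k → ℝ, w ⬝ᵥ w < s → (w - m) ⬝ᵥ (A *ᵥ (w - m)) ≤ s) : A = 1 ∧ m = 0 := by
  rcases Nat.eq_zero_or_pos k with rfl | hk
  · exact ⟨Subsingleton.elim _ _, Subsingleton.elim _ _⟩
  -- Adding the hypotheses at `w` and `-w` cancels the terms that are linear in `w`.
  have havg : ∀ w : Fin k → ℝ, w ⬝ᵥ w < s → w ⬝ᵥ (A *ᵥ w) + m ⬝ᵥ (A *ᵥ m) ≤ s := by
    intro w hw
    have h1 := h w hw
    have h2 := h (-w) (by simpa using hw)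
    simp only [mulVec_sub, mulVec_neg, sub_dotProduct, dotProduct_sub, neg_dotProduct,
      dotProduct_neg] at h1 h2
    linarith
  have hm0 : 0 ≤ m ⬝ᵥ (A *ᵥ m) := by simpa using hA.posSemidef.dotProduct_mulVec_nonneg m
  have heig : ∀ i, s * hA.1.eigenvalues i + m ⬝ᵥ (A *ᵥ m) ≤ s := by
    intro i
    set v : Fin k → ℝ := (hA.1.eigenvectorBasis i).ofLp with hv
    have hvv : v ⬝ᵥ v = 1 := by
      have := hA.1.eigenvectorBasis.inner_eq_one i
      rw [EuclideanSpace.inner_eq_star_dotProduct] at this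
      simpa using this
    have hAv : A *ᵥ v = hA.1.eigenvalues i • v := hA.1.mulVec_eigenvectorBasis i
    -- The hypothesis only covers the open ball, so `√t • v` is tested for `t < s` and then `t`
    -- tends to `s`.
    have hr : ∀ t ∈ Set.Ico 0 s, t * hA.1.eigenvalues i + m ⬝ᵥ (A *ᵥ m) ≤ s := by
      intro t ht
      have e : Real.sqrt t * Real.sqrt t = t := Real.mul_self_sqrt ht.1
      have := havg (Real.sqrt t • v) (by
        simp only [smul_dotProduct, dotProduct_smul, hvv, smul_eq_mul, mul_one]
        linarith [ht.2])
      simp only [mulVec_smul, hAv, smul_dotProduct, dotProduct_smul, hvv, smul_eq_mul] at this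
      rw [← e]
      linarith
    have hmem : s ∈ closure (Set.Ico 0 s) := by
      rw [closure_Ico hs.ne]; exact ⟨hs.le, le_rfl⟩
    have hcl : IsClosed {t : ℝ | t * hA.1.eigenvalues i + m ⬝ᵥ (A *ᵥ m) ≤ s} :=
      isClosed_le (by fun_prop) continuous_const
    exact closure_minimal hr hcl hmem
  have hle : ∀ i, hA.1.eigenvalues i ≤ 1 := fun i => by
    have := heig i
    by_contra! hc
    nlinarith
  have hpos := hA.eigenvalues_pos
  -- Eigenvalues in `(0, 1]` with product at least `1` are all `1`.
  have hone : ∀ i, hA.1.eigenvalues i = 1 := by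
    by_contra! hc
    obtain ⟨i, hi⟩ := hc
    have : ∏ i, hA.1.eigenvalues i < ∏ _i : Fin k, (1 : ℝ) :=
      Finset.prod_lt_prod (fun i _ => hpos i) (fun i _ => hle i)
        ⟨i, Finset.mem_univ _, lt_of_le_of_ne (hle i) hi⟩
    rw [hA.1.det_eq_prod_eigenvalues] at hdet
    simp at this hdet
    linarith
  constructor
  · have := hA.1.spectral_theorem
    have hd : diagonal (RCLike.ofReal ∘ hA.1.eigenvalues : Fin k → ℝ) = 1 := by
      rw [← diagonal_one]; congr 1; ext i; simp [hone]
    rw [hd, map_one] at this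
    exact this
  -- With eigenvalue `1` the bound leaves `m ⬝ᵥ (A *ᵥ m) ≤ 0`.
  · have := heig ⟨0, hk⟩
    rw [hone] at this
    by_contra hc
    have := hA.dotProduct_mulVec_pos hc
    simp at this
    linarith

/-- An ellipsoid contained in an ellipsoid of no larger volume coincides with it. -/
theorem eq_of_quadForm_sublevel_subset {k : ℕ} {S S₀ : Matrix (Fin k) (Fin k) ℝ} (hS : S.PosDef)
    (hS₀ : S₀.PosDef) (hdet : S.det ≤ S₀.det) (μ μ₀ : Fin k → ℝ) {s : ℝ} (hs : 0 < s)
    (h : ∀ y, quadForm y μ₀ S₀ < s → quadForm y μ S ≤ s) : μ = μ₀ ∧ S = S₀ := by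
  obtain ⟨B, hB, rfl⟩ := hS₀.exists_eq_mul_transpose
  have hBu : IsUnit B.det := hB.isUnit
  have hm : B *ᵥ (B⁻¹ *ᵥ (μ - μ₀)) + μ₀ = μ := by
    rw [mulVec_mulVec, mul_nonsing_inv _ hBu, one_mulVec]; abel
  have hA : (Bᵀ * S⁻¹ * B).PosDef := by
    have := hS.inv.conjTranspose_mul_mul_same (B := B)
      (mulVec_injective_of_isUnit ((isUnit_iff_isUnit_det _).2 hBu))
    rwa [conjTranspose_eq_transpose_of_trivial] at this
  -- This determinant is the ratio of the determinants of `B * Bᵀ` and `S`.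
  have hdA : 1 ≤ (Bᵀ * S⁻¹ * B).det := by
    have hp := hS.det_pos
    rw [det_mul, det_transpose] at hdet
    rw [det_mul, det_mul, det_transpose, det_nonsing_inv, Ring.inverse_eq_inv']
    rw [show B.det * (S.det)⁻¹ * B.det = (B.det * B.det) / S.det by field_simp, le_div_iff₀ hp]
    linarith
  obtain ⟨h1, h2⟩ := hA.eq_one_of_ball_subset hdA (B⁻¹ *ᵥ (μ - μ₀)) hs fun w hw => by
    have := h (B *ᵥ w + μ₀) (by rwa [quadForm_mulVec_add_self hB])
    rw [← quadForm_mulVec_add B S w _ μ₀, hm]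
    exact this
  constructor
  · rw [h2] at hm; simpa using hm.symm
  · have e : S⁻¹ = (B * Bᵀ)⁻¹ := by
      have h3 := transpose_mul_inv_mul_cancel hB
      have hBT : IsUnit Bᵀ := by rw [isUnit_iff_isUnit_det, det_transpose]; exact hBu
      rw [← h1] at h3
      exact (hBT.mul_left_cancel (((isUnit_iff_isUnit_det _).2 hBu).mul_right_cancel h3)).symm
    have hi := congrArg (·⁻¹) e
    rwa [nonsing_inv_nonsing_inv _ hS.det_pos.ne'.isUnit,
      nonsing_inv_nonsing_inv _ hS₀.det_pos.ne'.isUnit] at hi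

/-! ### Affine change of variables for volume and elliptical laws -/

theorem volume_eq_smul_map_affine {k : ℕ} {B : Matrix (Fin k) (Fin k) ℝ} (hB : B.det ≠ 0)
    (μ : Fin k → ℝ) : (volume : Measure (Fin k → ℝ)) =
      ENNReal.ofReal |B.det| • volume.map (fun z => B *ᵥ z + μ) := by
  have h1 : (volume : Measure (Fin k → ℝ)).map (fun z => B *ᵥ z + μ) =
      ENNReal.ofReal |B.det⁻¹| • volume := by
    have h2 := Real.map_matrix_volume_pi_eq_smul_volume_pi hB
    have h3 : (fun z => B *ᵥ z + μ) = (fun y => y + μ) ∘ (toLin' B) := by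
      ext z; simp
    rw [h3, ← Measure.map_map (measurable_add_const μ)
      (LinearMap.continuous_of_finiteDimensional _).measurable, h2, Measure.map_smul,
      map_add_right_eq_self]
  rw [h1, smul_smul, ← ENNReal.ofReal_mul (abs_nonneg _), ← abs_mul, mul_inv_cancel₀ hB]
  simp

theorem sqrt_det_mul_transpose {k : ℕ} (B : Matrix (Fin k) (Fin k) ℝ) :
    Real.sqrt (B * Bᵀ).det = |B.det| := by
  rw [det_mul, det_transpose, Real.sqrt_mul_self_eq_abs]

theorem measurable_comp_quadForm {k : ℕ} {h : ℝ → ℝ} (h_anti : AntitoneOn h (Set.Ici 0))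
    {S : Matrix (Fin k) (Fin k) ℝ} (hS : S.PosDef) (μ : Fin k → ℝ) :
    Measurable fun y => h (quadForm y μ S) := by
  -- `h` is controlled only on `[0, ∞)`; truncating the argument makes it antitone on the whole
  -- line.
  have hg : Antitone fun t => h (max t 0) := fun a b hab =>
    h_anti (Set.mem_Ici.2 (le_max_right _ _)) (Set.mem_Ici.2 (le_max_right _ _))
      (max_le_max_right _ hab)
  have := hg.measurable.comp (continuous_quadForm μ S).measurable
  simpa [Function.comp_def, max_eq_left (quadForm_nonneg hS _ μ)] using this

theorem volume_quadForm_preimage {k : ℕ} {S : Matrix (Fin k) (Fin k) ℝ} (hS : S.PosDef)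
    (μ : Fin k → ℝ) {D : Set ℝ} (hD : MeasurableSet D) :
    volume {y | quadForm y μ S ∈ D} =
      ENNReal.ofReal (Real.sqrt S.det) * volume {z : Fin k → ℝ | z ⬝ᵥ z ∈ D} := by
  obtain ⟨B, hB, rfl⟩ := hS.exists_eq_mul_transpose
  rw [sqrt_det_mul_transpose]
  conv_lhs => rw [volume_eq_smul_map_affine hB μ]
  have hm : MeasurableSet {y | quadForm y μ (B * Bᵀ) ∈ D} :=
    (continuous_quadForm μ _).measurable hD
  rw [Measure.smul_apply, Measure.map_apply (by fun_prop) hm]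
  simp [quadForm_mulVec_add_self hB]

theorem ellipticalMeasure_eq_map {k : ℕ} {h : ℝ → ℝ} (h_anti : AntitoneOn h (Set.Ici 0))
    {B : Matrix (Fin k) (Fin k) ℝ} (hB : B.det ≠ 0) (hS : (B * Bᵀ).PosDef) (μ : Fin k → ℝ) :
    ellipticalMeasure h μ (B * Bᵀ) =
      (ellipticalMeasure h (0 : Fin k → ℝ) 1).map (fun z => B *ᵥ z + μ) := by
  have hT : Measurable fun z : Fin k → ℝ => B *ᵥ z + μ := by fun_prop
  have hm : Measurable fun y => ENNReal.ofReal (ellipticalDensity h μ (B * Bᵀ) y) :=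
    ((measurable_comp_quadForm h_anti hS μ).const_mul _).ennreal_ofReal
  ext A hA
  rw [Measure.map_apply hT hA, ellipticalMeasure, ellipticalMeasure, withDensity_apply _ hA,
    withDensity_apply _ (hT hA)]
  conv_lhs => rw [volume_eq_smul_map_affine hB μ]
  rw [Measure.restrict_smul, lintegral_smul_measure, setLIntegral_map hA hm hT, smul_eq_mul,
    ← lintegral_const_mul' _ _ ENNReal.ofReal_ne_top]
  refine lintegral_congr fun z => ?_
  rw [← ENNReal.ofReal_mul (abs_nonneg _)]
  simp only [ellipticalDensity, quadForm_mulVec_add_self hB, quadForm_zero_one,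
    sqrt_det_mul_transpose]
  rw [← mul_assoc, mul_inv_cancel₀ (abs_ne_zero.2 hB)]
  simp

theorem isProbabilityMeasure_ellipticalMeasure {k : ℕ} {h : ℝ → ℝ}
    (h_anti : AntitoneOn h (Set.Ici 0))
    (h_dens : IsProbabilityMeasure (ellipticalMeasure h (0 : Fin k → ℝ) 1))
    {S : Matrix (Fin k) (Fin k) ℝ} (hS : S.PosDef) (μ : Fin k → ℝ) :
    IsProbabilityMeasure (ellipticalMeasure h μ S) := by
  obtain ⟨B, hB, rfl⟩ := hS.exists_eq_mul_transpose
  rw [ellipticalMeasure_eq_map h_anti hB hS]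
  exact Measure.isProbabilityMeasure_map (by fun_prop)

theorem integral_comp_quadForm_ellipticalMeasure {k : ℕ} {h : ℝ → ℝ}
    (h_anti : AntitoneOn h (Set.Ici 0)) {g : ℝ → ℝ} (hg : Measurable g)
    {S : Matrix (Fin k) (Fin k) ℝ} (hS : S.PosDef) (μ : Fin k → ℝ) :
    ∫ y, g (quadForm y μ S) ∂(ellipticalMeasure h μ S) =
      ∫ z, g (z ⬝ᵥ z) ∂(ellipticalMeasure h (0 : Fin k → ℝ) 1) := by
  obtain ⟨B, hB, rfl⟩ := hS.exists_eq_mul_transpose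
  have hm : Measurable fun y => g (quadForm y μ (B * Bᵀ)) :=
    hg.comp (continuous_quadForm _ _).measurable
  rw [ellipticalMeasure_eq_map h_anti hB hS, integral_map (by fun_prop) hm.aestronglyMeasurable]
  simp [quadForm_mulVec_add_self hB]

/-! ### The bathtub inequality for ellipsoids -/

/-- The level is the supremum of `h` off `D` on the half-line. It exists without continuity of `h`,
since `D` is bounded above and `h ≤ h 0` there. -/
theorem AntitoneOn.exists_level_of_isLowerSet {h : ℝ → ℝ} (h_nonneg : ∀ t, 0 ≤ t → 0 ≤ h t)
    (h_anti : AntitoneOn h (Set.Ici 0)) {D : Set ℝ} (hD : IsLowerSet D) {R : ℝ}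
    (hR : D ⊆ Set.Iio R) :
    ∃ c, 0 ≤ c ∧ (∀ x ∈ D, 0 ≤ x → c ≤ h x) ∧ ∀ x, x ∉ D → 0 ≤ x → h x ≤ c := by
  have hne : (h '' {x | x ∉ D ∧ 0 ≤ x}).Nonempty :=
    ⟨_, max R 0, ⟨fun hc => absurd (hR hc) (by simp), le_max_right _ _⟩, rfl⟩
  have hbdd : BddAbove (h '' {x | x ∉ D ∧ 0 ≤ x}) := by
    refine ⟨h 0, ?_⟩
    rintro _ ⟨x, ⟨-, hx⟩, rfl⟩
    exact h_anti (Set.mem_Ici.2 le_rfl) hx hx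
  refine ⟨sSup (h '' {x | x ∉ D ∧ 0 ≤ x}), ?_, ?_, ?_⟩
  · apply Real.sSup_nonneg
    rintro _ ⟨x, ⟨-, hx⟩, rfl⟩
    exact h_nonneg x hx
  · intro x hx hx0
    refine csSup_le hne ?_
    rintro _ ⟨y, ⟨hy, hy0⟩, rfl⟩
    have hxy : x ≤ y := le_of_not_ge fun hc => hy (hD hc hx)
    exact h_anti hx0 hy0 hxy
  · exact fun x hx hx0 => le_csSup hbdd ⟨x, ⟨hx, hx0⟩, rfl⟩

theorem volume_dotProduct_self_preimage_lt_top {k : ℕ} {D : Set ℝ} {R : ℝ}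
    (hR : D ⊆ Set.Iio R) : volume {z : Fin k → ℝ | z ⬝ᵥ z ∈ D} < ⊤ := by
  refine lt_of_le_of_lt (measure_mono ?_)
    (measure_Icc_lt_top (a := fun _ : Fin k => -(R + 1)) (b := fun _ => R + 1))
  intro z hz
  have hz' : z ⬝ᵥ z < R := hR hz
  have hi : ∀ i, z i * z i < R := fun i =>
    lt_of_le_of_lt (Finset.single_le_sum (f := fun i => z i * z i)
      (fun i _ => mul_self_nonneg _) (Finset.mem_univ i)) hz'
  constructor <;> intro i <;> have := hi i <;> simp only <;> nlinarith

section

variable {k : ℕ} {h : ℝ → ℝ} {S S₀ : Matrix (Fin k) (Fin k) ℝ} {μ μ₀ : Fin k → ℝ}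

theorem integrable_ellipticalDensity (h_nonneg : ∀ t, 0 ≤ t → 0 ≤ h t)
    (h_anti : AntitoneOn h (Set.Ici 0))
    (h_dens : IsProbabilityMeasure (ellipticalMeasure h (0 : Fin k → ℝ) 1))
    (hS : S.PosDef) (μ : Fin k → ℝ) : Integrable (ellipticalDensity h μ S) := by
  have hp := isProbabilityMeasure_ellipticalMeasure h_anti h_dens hS μ
  have h0 : ∀ y, 0 ≤ ellipticalDensity h μ S y := fun y =>
    mul_nonneg (by positivity) (h_nonneg _ (quadForm_nonneg hS y μ))
  have hm : Measurable (ellipticalDensity h μ S) :=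
    (measurable_comp_quadForm h_anti hS μ).const_mul _
  refine ⟨hm.aestronglyMeasurable, ?_⟩
  rw [hasFiniteIntegral_iff_ofReal (Filter.Eventually.of_forall h0)]
  have : ellipticalMeasure h μ S Set.univ < ⊤ := measure_lt_top _ _
  rwa [ellipticalMeasure, withDensity_apply _ MeasurableSet.univ, Measure.restrict_univ] at this

theorem ellipticalMeasure_real_apply (h_nonneg : ∀ t, 0 ≤ t → 0 ≤ h t)
    (h_anti : AntitoneOn h (Set.Ici 0)) (hS : S.PosDef) (μ : Fin k → ℝ) {A : Set (Fin k → ℝ)}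
    (hA : MeasurableSet A) :
    (ellipticalMeasure h μ S).real A = ∫ y in A, ellipticalDensity h μ S y := by
  have h0 : ∀ y, 0 ≤ ellipticalDensity h μ S y := fun y =>
    mul_nonneg (by positivity) (h_nonneg _ (quadForm_nonneg hS y μ))
  have hm : Measurable (ellipticalDensity h μ S) :=
    (measurable_comp_quadForm h_anti hS μ).const_mul _
  rw [integral_eq_lintegral_of_nonneg_ae (Filter.Eventually.of_forall h0)
    hm.aestronglyMeasurable, Measure.real, ellipticalMeasure, withDensity_apply _ hA]

/-- The mass gained by moving an ellipsoid onto the level ellipsoid of the density, written with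
an integrand that is nonnegative when `c` is the level of `h` at the boundary of `D`. -/
theorem ellipticalMeasure_sub_eq_integral (h_nonneg : ∀ t, 0 ≤ t → 0 ≤ h t)
    (h_anti : AntitoneOn h (Set.Ici 0))
    (h_dens : IsProbabilityMeasure (ellipticalMeasure h (0 : Fin k → ℝ) 1))
    (hS₀ : S₀.PosDef) {E E₀ : Set (Fin k → ℝ)} (hE : MeasurableSet E) (hE₀ : MeasurableSet E₀)
    (hfin : volume E ≠ ⊤) (hfin₀ : volume E₀ ≠ ⊤) (c : ℝ) :
    Integrable (fun y => (E₀.indicator 1 y - E.indicator 1 y) *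
        ((Real.sqrt S₀.det)⁻¹ * (h (quadForm y μ₀ S₀) - c))) ∧
    (ellipticalMeasure h μ₀ S₀).real E₀ - (ellipticalMeasure h μ₀ S₀).real E =
      (∫ y, (E₀.indicator 1 y - E.indicator 1 y) *
        ((Real.sqrt S₀.det)⁻¹ * (h (quadForm y μ₀ S₀) - c))) +
      (Real.sqrt S₀.det)⁻¹ * c * (volume.real E₀ - volume.real E) := by
  have hi := integrable_ellipticalDensity h_nonneg h_anti h_dens hS₀ μ₀
  have i1 : ∀ {A : Set (Fin k → ℝ)}, MeasurableSet A → volume A ≠ ⊤ →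
      Integrable (fun y => A.indicator (ellipticalDensity h μ₀ S₀) y -
        (Real.sqrt S₀.det)⁻¹ * c * A.indicator 1 y) ∧
      ∫ y, (A.indicator (ellipticalDensity h μ₀ S₀) y -
        (Real.sqrt S₀.det)⁻¹ * c * A.indicator 1 y) =
        (ellipticalMeasure h μ₀ S₀).real A - (Real.sqrt S₀.det)⁻¹ * c * volume.real A := by
    intro A hA hAf
    have a1 := hi.indicator hA
    have a2 : Integrable (A.indicator (1 : (Fin k → ℝ) → ℝ)) :=
      (integrable_indicator_iff hA).2 (integrableOn_const hAf)
    refine ⟨a1.sub (a2.const_mul _), ?_⟩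
    rw [integral_sub a1 (a2.const_mul _), integral_const_mul, integral_indicator hA,
      integral_indicator_one hA, ellipticalMeasure_real_apply h_nonneg h_anti hS₀ μ₀ hA]
  obtain ⟨j, e⟩ := i1 hE hfin
  obtain ⟨j₀, e₀⟩ := i1 hE₀ hfin₀
  have hF : (fun y => (E₀.indicator 1 y - E.indicator 1 y) *
        ((Real.sqrt S₀.det)⁻¹ * (h (quadForm y μ₀ S₀) - c))) =
      fun y => (E₀.indicator (ellipticalDensity h μ₀ S₀) y -
          (Real.sqrt S₀.det)⁻¹ * c * E₀.indicator 1 y) -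
        (E.indicator (ellipticalDensity h μ₀ S₀) y -
          (Real.sqrt S₀.det)⁻¹ * c * E.indicator 1 y) := by
    ext y
    by_cases h1 : y ∈ E <;> by_cases h2 : y ∈ E₀ <;> simp [h1, h2, ellipticalDensity] <;> ring
  rw [hF]
  refine ⟨j₀.sub j, ?_⟩
  rw [integral_sub j₀ j, e, e₀]
  ring

/-- The two factors never have opposite signs: the indicator difference is `1` only where `h ≥ c`
and `-1` only where `h ≤ c`. -/
theorem bathtub_integrand_nonneg {D : Set ℝ} (hS₀ : S₀.PosDef) {c : ℝ}
    (hc1 : ∀ x ∈ D, 0 ≤ x → c ≤ h x) (hc2 : ∀ x, x ∉ D → 0 ≤ x → h x ≤ c) (y : Fin k → ℝ) :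
    0 ≤ ({y | quadForm y μ₀ S₀ ∈ D}.indicator 1 y - {y | quadForm y μ S ∈ D}.indicator 1 y) *
        ((Real.sqrt S₀.det)⁻¹ * (h (quadForm y μ₀ S₀) - c)) := by
  have h0 := quadForm_nonneg hS₀ y μ₀
  have hr : 0 ≤ (Real.sqrt S₀.det)⁻¹ := by positivity
  by_cases h2 : quadForm y μ₀ S₀ ∈ D
  · have := mul_nonneg hr (sub_nonneg.2 (hc1 _ h2 h0))
    by_cases h1 : quadForm y μ S ∈ D <;> simp [h1, h2, -mul_nonneg_iff_of_pos_left]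
    linarith
  · have := mul_nonneg hr (sub_nonneg.2 (hc2 _ h2 h0))
    by_cases h1 : quadForm y μ S ∈ D <;> simp [h1, h2]
    linarith

theorem volume_real_quadForm_preimage (hS : S.PosDef) (μ : Fin k → ℝ) {D : Set ℝ}
    (hD : MeasurableSet D) : volume.real {y | quadForm y μ S ∈ D} =
      Real.sqrt S.det * volume.real {z : Fin k → ℝ | z ⬝ᵥ z ∈ D} := by
  rw [Measure.real, volume_quadForm_preimage hS μ hD, ENNReal.toReal_mul,
    ENNReal.toReal_ofReal (Real.sqrt_nonneg _), Measure.real]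

/-- The mass difference is a nonnegative bathtub integral plus `c` times a nonnegative volume
difference. The jump `h b < h a` across the edge of `D` makes one of the two positive. -/
theorem ellipticalMeasure_quadForm_preimage_le (h_nonneg : ∀ t, 0 ≤ t → 0 ≤ h t)
    (h_anti : AntitoneOn h (Set.Ici 0))
    (h_dens : IsProbabilityMeasure (ellipticalMeasure h (0 : Fin k → ℝ) 1))
    (hS : S.PosDef) (hS₀ : S₀.PosDef) (hdet : S.det ≤ S₀.det)
    {D : Set ℝ} (hD : IsLowerSet D) {R : ℝ} (hR : D ⊆ Set.Iio R) :
    (ellipticalMeasure h μ₀ S₀).real {y | quadForm y μ S ∈ D} ≤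
      (ellipticalMeasure h μ₀ S₀).real {y | quadForm y μ₀ S₀ ∈ D} ∧
    ∀ a b, 0 ≤ a → a ∈ D → b ∉ D → h b < h a →
      (∃ y, quadForm y μ₀ S₀ < a ∧ b < quadForm y μ S) →
      ((∃ y, quadForm y μ S < a ∧ b < quadForm y μ₀ S₀) ∨ S.det < S₀.det) →
      (ellipticalMeasure h μ₀ S₀).real {y | quadForm y μ S ∈ D} <
        (ellipticalMeasure h μ₀ S₀).real {y | quadForm y μ₀ S₀ ∈ D} := by
  obtain ⟨c, hc0, hc1, hc2⟩ := h_anti.exists_level_of_isLowerSet h_nonneg hD hR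
  have hDm : MeasurableSet D := hD.ordConnected.measurableSet
  have hv := volume_dotProduct_self_preimage_lt_top (k := k) hR
  have hE : MeasurableSet {y | quadForm y μ S ∈ D} := (continuous_quadForm μ S).measurable hDm
  have hE₀ : MeasurableSet {y | quadForm y μ₀ S₀ ∈ D} :=
    (continuous_quadForm μ₀ S₀).measurable hDm
  have hf : volume {y | quadForm y μ S ∈ D} ≠ ⊤ := by
    rw [volume_quadForm_preimage hS μ hDm]
    exact ENNReal.mul_ne_top ENNReal.ofReal_ne_top hv.ne
  have hf₀ : volume {y | quadForm y μ₀ S₀ ∈ D} ≠ ⊤ := by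
    rw [volume_quadForm_preimage hS₀ μ₀ hDm]
    exact ENNReal.mul_ne_top ENNReal.ofReal_ne_top hv.ne
  obtain ⟨hint, heq⟩ := ellipticalMeasure_sub_eq_integral (μ₀ := μ₀) h_nonneg h_anti h_dens hS₀
    hE hE₀ hf hf₀ c
  have hnn := bathtub_integrand_nonneg (μ := μ) (S := S) (μ₀ := μ₀) hS₀ hc1 hc2
  have hr : 0 < (Real.sqrt S₀.det)⁻¹ := inv_pos.2 (Real.sqrt_pos.2 hS₀.det_pos)
  have hI := integral_nonneg_of_ae (μ := volume)
    (Filter.Eventually.of_forall hnn)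
  rw [volume_real_quadForm_preimage hS μ hDm, volume_real_quadForm_preimage hS₀ μ₀ hDm,
    ← sub_mul] at heq
  have hsq : 0 ≤ Real.sqrt S₀.det - Real.sqrt S.det := sub_nonneg.2 (Real.sqrt_le_sqrt hdet)
  have hV : 0 ≤ (Real.sqrt S₀.det)⁻¹ * c * ((Real.sqrt S₀.det - Real.sqrt S.det) *
      volume.real {z : Fin k → ℝ | z ⬝ᵥ z ∈ D}) := by positivity
  refine ⟨by linarith, fun a b ha haD hbD hab hU' hU => ?_⟩
  -- The integrand is nonnegative, so being nonzero on a nonempty open set makes its integral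
  -- positive.
  have hposI : ∀ U : Set (Fin k → ℝ), IsOpen U → U.Nonempty →
      (∀ y ∈ U, ({y | quadForm y μ₀ S₀ ∈ D}.indicator 1 y -
        {y | quadForm y μ S ∈ D}.indicator 1 y) *
        ((Real.sqrt S₀.det)⁻¹ * (h (quadForm y μ₀ S₀) - c)) ≠ 0) →
      0 < ∫ y, ({y | quadForm y μ₀ S₀ ∈ D}.indicator 1 y -
        {y | quadForm y μ S ∈ D}.indicator 1 y) *
        ((Real.sqrt S₀.det)⁻¹ * (h (quadForm y μ₀ S₀) - c)) := by
    intro U hUo hUn hne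
    rw [integral_pos_iff_support_of_nonneg hnn hint]
    exact (hUo.measure_pos volume hUn).trans_le (measure_mono hne)
  have hmem : ∀ {x}, x < a → x ∈ D := fun hx => hD hx.le haD
  have hnmem : ∀ {x}, b < x → x ∉ D := fun hx hc => hbD (hD hx.le hc)
  have hb : 0 ≤ b := by
    by_contra! hb
    exact hbD (hD (hb.le.trans ha) haD)
  have hUo' : IsOpen {y | quadForm y μ₀ S₀ < a ∧ b < quadForm y μ S} :=
    (isOpen_lt (continuous_quadForm _ _) continuous_const).inter
      (isOpen_lt continuous_const (continuous_quadForm _ _))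
  have hUo : IsOpen {y | quadForm y μ S < a ∧ b < quadForm y μ₀ S₀} :=
    (isOpen_lt (continuous_quadForm _ _) continuous_const).inter
      (isOpen_lt continuous_const (continuous_quadForm _ _))
  -- If `c < h a`, the gain comes from points inside the reference ellipsoid and outside the other.
  -- Otherwise `h b < h a ≤ c`, and it comes from the reverse difference or from the volume term.
  rcases lt_or_ge c (h a) with hca | hca
  · have := hposI _ hUo' hU' fun y hy => by
      have h1 : h a ≤ h (quadForm y μ₀ S₀) := h_anti (quadForm_nonneg hS₀ y μ₀) ha hy.1.le
      have : 0 < (Real.sqrt S₀.det)⁻¹ * (h (quadForm y μ₀ S₀) - c) :=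
        mul_pos hr (by linarith)
      simpa [hmem hy.1, hnmem hy.2] using this.ne'
    linarith
  · rcases hU with hU | hU
    · have := hposI _ hUo hU fun y hy => by
        have h1 : h (quadForm y μ₀ S₀) ≤ h b := h_anti hb (quadForm_nonneg hS₀ y μ₀) hy.2.le
        have : 0 < (Real.sqrt S₀.det)⁻¹ * (c - h (quadForm y μ₀ S₀)) :=
          mul_pos hr (by linarith)
        have e : c - h (quadForm y μ₀ S₀) ≠ 0 := right_ne_zero_of_mul this.ne'
        rw [Set.indicator_of_notMem (by exact hnmem hy.2),
          Set.indicator_of_mem (by exact hmem hy.1)]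
        simp only [Pi.one_apply, zero_sub]
        nlinarith
      linarith
    · have hcpos : 0 < c := by linarith [h_nonneg b hb]
      have hE₀pos : 0 < volume {y | quadForm y μ₀ S₀ ∈ D} :=
        (hUo'.measure_pos volume hU').trans_le (measure_mono fun y hy => hmem hy.1)
      rw [volume_quadForm_preimage hS₀ μ₀ hDm] at hE₀pos
      have hvpos : 0 < volume.real {z : Fin k → ℝ | z ⬝ᵥ z ∈ D} :=
        ENNReal.toReal_pos (pos_of_mul_pos_right hE₀pos zero_le).ne' hv.ne
      have hs' : 0 < Real.sqrt S₀.det - Real.sqrt S.det :=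
        sub_pos.2 (Real.sqrt_lt_sqrt hS.det_pos.le hU)
      have : 0 < (Real.sqrt S₀.det)⁻¹ * c * ((Real.sqrt S₀.det - Real.sqrt S.det) *
        volume.real {z : Fin k → ℝ | z ⬝ᵥ z ∈ D}) := by positivity
      linarith

end

/-! ### Strict inequality by the layer-cake formula -/

/-- Rigidity at level `s` gives points with strict inequalities, which leave room for `a` and `b`.
With equal determinants it applies in both directions, and one pair `a, b` is chosen to serve both
witnesses. -/
theorem exists_strict_levels {k : ℕ} {S S₀ : Matrix (Fin k) (Fin k) ℝ} {μ μ₀ : Fin k → ℝ}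
    (hS : S.PosDef) (hS₀ : S₀.PosDef) (hdet : S.det ≤ S₀.det) {s : ℝ} (hs : 0 < s)
    (hne : ¬(μ = μ₀ ∧ S = S₀)) :
    ∃ a b, 0 ≤ a ∧ a < s ∧ s < b ∧ (∃ y, quadForm y μ₀ S₀ < a ∧ b < quadForm y μ S) ∧
      ((∃ y, quadForm y μ S < a ∧ b < quadForm y μ₀ S₀) ∨ S.det < S₀.det) := by
  have h1 : ∃ y, quadForm y μ₀ S₀ < s ∧ s < quadForm y μ S := by
    by_contra! hc
    exact hne (eq_of_quadForm_sublevel_subset hS hS₀ hdet μ μ₀ hs hc)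
  obtain ⟨y₁, h11, h12⟩ := h1
  have hy₁ := quadForm_nonneg hS₀ y₁ μ₀
  rcases hdet.lt_or_eq with hlt | heq
  · obtain ⟨a, ha1, ha2⟩ := exists_between h11
    obtain ⟨b, hb1, hb2⟩ := exists_between h12
    exact ⟨a, b, hy₁.trans ha1.le, ha2, hb1, ⟨y₁, ha1, hb2⟩, Or.inr hlt⟩
  · have h2 : ∃ y, quadForm y μ S < s ∧ s < quadForm y μ₀ S₀ := by
      by_contra! hc
      obtain ⟨e1, e2⟩ := eq_of_quadForm_sublevel_subset hS₀ hS heq.ge μ₀ μ hs hc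
      exact hne ⟨e1.symm, e2.symm⟩
    obtain ⟨y₂, h21, h22⟩ := h2
    obtain ⟨a, ha1, ha2⟩ := exists_between (max_lt h11 h21)
    obtain ⟨b, hb1, hb2⟩ := exists_between (lt_min h12 h22)
    rw [max_lt_iff] at ha1
    rw [lt_min_iff] at hb2
    exact ⟨a, b, hy₁.trans ha1.1.le, ha2, hb1, ⟨y₁, ha1.1, hb2.1⟩, Or.inl ⟨y₂, ha1.2, hb2.2⟩⟩

theorem integral_comp_quadForm_lt {k : ℕ} {h : ℝ → ℝ} (h_nonneg : ∀ t, 0 ≤ t → 0 ≤ h t)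
    (h_anti : AntitoneOn h (Set.Ici 0))
    (h_dens : IsProbabilityMeasure (ellipticalMeasure h (0 : Fin k → ℝ) 1))
    {ψ : ℝ → ℝ} (hψ : Antitone ψ) (hψ0 : ∀ t, 0 ≤ ψ t) {R : ℝ} (hψR : ∀ t, R ≤ t → ψ t = 0)
    {s : ℝ} (hhs : IsPointOfDecrease h s) (hψs : IsPointOfDecrease ψ s)
    {S S₀ : Matrix (Fin k) (Fin k) ℝ} {μ μ₀ : Fin k → ℝ}
    (hS : S.PosDef) (hS₀ : S₀.PosDef) (hdet : S.det ≤ S₀.det) (hne : ¬(μ = μ₀ ∧ S = S₀)) :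
    ∫ y, ψ (quadForm y μ S) ∂(ellipticalMeasure h μ₀ S₀) <
      ∫ y, ψ (quadForm y μ₀ S₀) ∂(ellipticalMeasure h μ₀ S₀) := by
  have hp := isProbabilityMeasure_ellipticalMeasure h_anti h_dens hS₀ μ₀
  set P := ellipticalMeasure h μ₀ S₀
  have hm : ∀ (ν : Fin k → ℝ) (T : Matrix (Fin k) (Fin k) ℝ),
      Measurable fun y => ψ (quadForm y ν T) :=
    fun ν T => hψ.measurable.comp (continuous_quadForm ν T).measurable
  have hi : ∀ (ν : Fin k → ℝ) {T : Matrix (Fin k) (Fin k) ℝ}, T.PosDef →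
      Integrable (fun y => ψ (quadForm y ν T)) P := fun ν T hT =>
    Integrable.of_bound (hm ν T).aestronglyMeasurable (ψ 0) (Filter.Eventually.of_forall fun y => by
      rw [Real.norm_of_nonneg (hψ0 _)]
      exact hψ (quadForm_nonneg hT y ν))
  have hlc : ∀ (ν : Fin k → ℝ) {T : Matrix (Fin k) (Fin k) ℝ}, T.PosDef →
      ENNReal.ofReal (∫ y, ψ (quadForm y ν T) ∂P) =
        ∫⁻ u in Set.Ioi 0, P {y | u < ψ (quadForm y ν T)} := fun ν T hT => by
    have h0 : 0 ≤ᵐ[P] fun y => ψ (quadForm y ν T) := Filter.Eventually.of_forall fun y => hψ0 _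
    rw [ofReal_integral_eq_lintegral_ofReal (hi ν hT) h0,
      lintegral_eq_lintegral_meas_lt P h0 (hm ν T).aemeasurable]
  have hlower : ∀ u, IsLowerSet {t | u < ψ t} := fun u x y hyx hx => lt_of_lt_of_le hx (hψ hyx)
  have hbdd : ∀ u, 0 < u → {t | u < ψ t} ⊆ Set.Iio R := fun u hu t ht => by
    by_contra hc
    have : u < ψ t := ht
    rw [hψR t (not_lt.1 hc)] at this
    linarith
  obtain ⟨a, b, ha, has, hsb, hU', hU⟩ := exists_strict_levels hS hS₀ hdet hhs.1 hne
  have hab := hhs.2 a b ha has hsb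
  have hψab := hψs.2 a b ha has hsb
  have hlt : ENNReal.ofReal (∫ y, ψ (quadForm y μ S) ∂P) <
      ENNReal.ofReal (∫ y, ψ (quadForm y μ₀ S₀) ∂P) := by
    rw [hlc μ hS, hlc μ₀ hS₀]
    -- For `u` in `(ψ b, ψ a)` the superlevel set contains `a` but not `b`, so the strict bathtub
    -- inequality applies on an interval of positive length.
    refine lintegral_strict_mono_of_ae_le_of_ae_lt_on (s := Set.Ioo (ψ b) (ψ a)) ?_ ?_ ?_ ?_ ?_
    · refine Antitone.measurable (fun u v huv => measure_mono fun y hy => ?_) |>.aemeasurable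
      exact lt_of_le_of_lt huv hy
    · rw [← hlc μ hS]
      exact ENNReal.ofReal_ne_top
    · refine (ae_restrict_iff' measurableSet_Ioi).2 (Filter.Eventually.of_forall fun u hu => ?_)
      have := (ellipticalMeasure_quadForm_preimage_le (μ := μ) (μ₀ := μ₀) h_nonneg h_anti h_dens
        hS hS₀ hdet (hlower u) (hbdd u hu)).1
      exact (ENNReal.toReal_le_toReal (measure_ne_top _ _) (measure_ne_top _ _)).1 this
    · rw [Measure.restrict_apply measurableSet_Ioo, Set.inter_eq_left.2
        (Set.Ioo_subset_Ioi_self.trans (Set.Ioi_subset_Ioi (hψ0 b)))]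
      simpa using hψab
    · refine (ae_restrict_iff' measurableSet_Ioi).2
        (Filter.Eventually.of_forall fun u hu huab => ?_)
      have := (ellipticalMeasure_quadForm_preimage_le (μ := μ) (μ₀ := μ₀) h_nonneg h_anti h_dens
        hS hS₀ hdet (hlower u) (hbdd u hu)).2 a b ha huab.2 (not_lt.2 huab.1.le) hab hU' hU
      exact (ENNReal.toReal_lt_toReal (measure_ne_top _ _) (measure_ne_top _ _)).1 this
  exact (ENNReal.ofReal_lt_ofReal_iff_of_nonneg (integral_nonneg fun y => hψ0 _)).1 hlt

/-! ### Application to the loss function -/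

theorem RhoR2.exists_monotone {ρ : ℝ → ℝ} (hR2 : RhoR2 ρ) :
    Monotone (fun t => ρ (Real.sqrt t)) ∧
      ∃ C R : ℝ, (∀ t, ρ (Real.sqrt t) ≤ C) ∧ ∀ t, R ≤ t → ρ (Real.sqrt t) = C := by
  obtain ⟨c, hc, hmono, hconst⟩ := hR2
  have hle : ∀ x, 0 ≤ x → ρ x ≤ ρ c := fun x hx => by
    rcases le_total x c with h | h
    · exact hmono ⟨hx, h⟩ ⟨hc.le, le_rfl⟩ h
    · exact (hconst x h).le
  refine ⟨fun x y hxy => ?_, ρ c, c ^ 2, fun t => hle _ (Real.sqrt_nonneg t), fun t ht =>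
    hconst _ (Real.le_sqrt_of_sq_le ht)⟩
  rcases le_total (Real.sqrt y) c with h | h
  · exact hmono ⟨Real.sqrt_nonneg x, (Real.sqrt_le_sqrt hxy).trans h⟩ ⟨Real.sqrt_nonneg y, h⟩
      (Real.sqrt_le_sqrt hxy)
  · simp only [hconst _ h]
    exact hle _ (Real.sqrt_nonneg x)

theorem integral_rho_lt {k : ℕ} {ρ h : ℝ → ℝ} (hR2 : RhoR2 ρ) (h_nonneg : ∀ t, 0 ≤ t → 0 ≤ h t)
    (h_anti : AntitoneOn h (Set.Ici 0))
    (h_dens : IsProbabilityMeasure (ellipticalMeasure h (0 : Fin k → ℝ) 1))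
    (h_common : ∃ s, IsPointOfDecrease h s ∧ IsPointOfDecrease (fun t => -ρ (Real.sqrt t)) s)
    {S S₀ : Matrix (Fin k) (Fin k) ℝ} {μ μ₀ : Fin k → ℝ}
    (hS : S.PosDef) (hS₀ : S₀.PosDef) (hdet : S.det ≤ S₀.det) (hne : ¬(μ = μ₀ ∧ S = S₀)) :
    ∫ y, ρ (Real.sqrt (quadForm y μ₀ S₀)) ∂(ellipticalMeasure h μ₀ S₀) <
      ∫ y, ρ (Real.sqrt (quadForm y μ S)) ∂(ellipticalMeasure h μ₀ S₀) := by
  obtain ⟨hmono, C, R, hC, hR⟩ := hR2.exists_monotone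
  obtain ⟨s, hhs, hρs⟩ := h_common
  have hp := isProbabilityMeasure_ellipticalMeasure h_anti h_dens hS₀ μ₀
  have hi : ∀ (ν : Fin k → ℝ) (T : Matrix (Fin k) (Fin k) ℝ),
      Integrable (fun y => ρ (Real.sqrt (quadForm y ν T))) (ellipticalMeasure h μ₀ S₀) :=
    fun ν T => by
      refine Integrable.of_mem_Icc (ρ (Real.sqrt 0)) C
        (hmono.measurable.comp (continuous_quadForm ν T).measurable).aemeasurable
        (Filter.Eventually.of_forall fun y => ⟨?_, hC _⟩)
      -- `T` need not be positive definite here; where the form is negative, its square root is `0`.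
      rcases le_total 0 (quadForm y ν T) with h0 | h0
      · exact hmono h0
      · simp [Real.sqrt_eq_zero_of_nonpos h0]
  have := integral_comp_quadForm_lt h_nonneg h_anti h_dens
    (ψ := fun t => C - ρ (Real.sqrt t)) (fun x y hxy => sub_le_sub_left (hmono hxy) C)
    (fun t => sub_nonneg.2 (hC t)) (R := R) (fun t ht => by simp [hR t ht]) hhs
    ⟨hρs.1, fun a b h1 h2 h3 => by have := hρs.2 a b h1 h2 h3; simp only at this ⊢; linarith⟩
    hS hS₀ hdet hne
  rw [integral_sub (integrable_const _) (hi _ _), integral_sub (integrable_const _) (hi _ _)]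
    at this
  linarith

/-! ### The minimization problem and conditioning on the design -/

theorem isSSolution_iff_of_unique {k q l : ℕ} {ρ : ℝ → ℝ} {b₀ : ℝ}
    {V : (Fin l → ℝ) → Matrix (Fin k) (Fin k) ℝ}
    {P : Measure ((Fin k → ℝ) × Matrix (Fin k) (Fin q) ℝ)} {β₀ : Fin q → ℝ} {θ₀ : Fin l → ℝ}
    (hfeas : SFeasible ρ b₀ V P β₀ θ₀)
    (huniq : ∀ β θ, SFeasible ρ b₀ V P β θ → (V θ).det ≤ (V θ₀).det → β = β₀ ∧ θ = θ₀)
    (β : Fin q → ℝ) (θ : Fin l → ℝ) : IsSSolution ρ b₀ V P β θ ↔ β = β₀ ∧ θ = θ₀ := by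
  constructor
  · rintro ⟨h1, h2⟩
    exact huniq β θ h1 (h2 β₀ θ₀ hfeas)
  · rintro ⟨rfl, rfl⟩
    refine ⟨hfeas, fun β' θ' h' => ?_⟩
    by_contra! hc
    obtain ⟨-, rfl⟩ := huniq β' θ' h' hc.le
    exact lt_irrefl _ hc

theorem measurable_quadForm_mulVec {k q : ℕ} (β : Fin q → ℝ) (S : Matrix (Fin k) (Fin k) ℝ) :
    Measurable fun s : (Fin k → ℝ) × Matrix (Fin k) (Fin q) ℝ => quadForm s.1 (s.2 *ᵥ β) S := by
  have h2 : ∀ i j, Measurable fun s : (Fin k → ℝ) × Matrix (Fin k) (Fin q) ℝ => s.2 i j :=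
    fun i j => by
      have e : Measurable fun X : Matrix (Fin k) (Fin q) ℝ => X i j :=
        (measurable_pi_apply j).comp (measurable_pi_apply (X := fun _ : Fin k => Fin q → ℝ) i)
      exact e.comp measurable_snd
  have h1 : Measurable fun s : (Fin k → ℝ) × Matrix (Fin k) (Fin q) ℝ => s.1 - s.2 *ᵥ β := by
    refine measurable_pi_lambda _ fun i => ?_
    simp only [Pi.sub_apply, mulVec, dotProduct]
    exact ((measurable_pi_apply i).comp measurable_fst).sub
      (Finset.measurable_sum _ fun j _ => (h2 i j).mul_const _)
  have h3 : Measurable fun z : Fin k → ℝ => z ⬝ᵥ (S⁻¹ *ᵥ z) :=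
    Continuous.measurable (by fun_prop)
  exact h3.comp h1

theorem RhoR2.measurable_comp_mahalanobis {k q : ℕ} {ρ : ℝ → ℝ} (hR2 : RhoR2 ρ) (β : Fin q → ℝ)
    (S : Matrix (Fin k) (Fin k) ℝ) :
    Measurable fun s : (Fin k → ℝ) × Matrix (Fin k) (Fin q) ℝ => ρ (mahalanobis s β S) :=
  hR2.exists_monotone.1.measurable.comp (measurable_quadForm_mulVec β S)

theorem RhoR2.integrable_comp_mahalanobis {k q : ℕ} {ρ : ℝ → ℝ} (hR2 : RhoR2 ρ) (β : Fin q → ℝ)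
    {S : Matrix (Fin k) (Fin k) ℝ} (hS : S.PosDef)
    (P : Measure ((Fin k → ℝ) × Matrix (Fin k) (Fin q) ℝ)) [IsFiniteMeasure P] :
    Integrable (fun s => ρ (mahalanobis s β S)) P := by
  obtain ⟨hmono, C, R, hC, -⟩ := hR2.exists_monotone
  exact Integrable.of_mem_Icc (ρ (Real.sqrt 0)) C (hR2.measurable_comp_mahalanobis β S).aemeasurable
    (Filter.Eventually.of_forall fun s => ⟨hmono (quadForm_nonneg hS _ _), hC _⟩)

/-- Disintegration of `P` over the design; the coordinates are swapped because `condDistrib`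
composes with the law of `X` in first position. -/
theorem integral_mahalanobis_eq_integral_condDistrib {k q : ℕ} {ρ : ℝ → ℝ} (hR2 : RhoR2 ρ)
    (β : Fin q → ℝ) {S : Matrix (Fin k) (Fin k) ℝ} (hS : S.PosDef)
    (P : Measure ((Fin k → ℝ) × Matrix (Fin k) (Fin q) ℝ)) [IsProbabilityMeasure P] :
    Integrable (fun X => ∫ y, ρ (Real.sqrt (quadForm y (X *ᵥ β) S))
      ∂(condDistrib Prod.fst Prod.snd P X)) (P.map Prod.snd) ∧
    ∫ s, ρ (mahalanobis s β S) ∂P = ∫ X, ∫ y, ρ (Real.sqrt (quadForm y (X *ᵥ β) S))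
      ∂(condDistrib Prod.fst Prod.snd P X) ∂(P.map Prod.snd) := by
  have hc := compProd_map_condDistrib (μ := P) (mβ := instMeasurableSpaceRealMatrix)
    (X := (Prod.snd : (Fin k → ℝ) × Matrix (Fin k) (Fin q) ℝ → Matrix (Fin k) (Fin q) ℝ))
    (Y := Prod.fst) measurable_fst.aemeasurable
  have hsw : (fun s : (Fin k → ℝ) × Matrix (Fin k) (Fin q) ℝ => (s.2, s.1)) = Prod.swap := rfl
  rw [hsw] at hc
  have hg : Measurable fun x : Matrix (Fin k) (Fin q) ℝ × (Fin k → ℝ) =>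
      ρ (mahalanobis x.swap β S) :=
    (hR2.measurable_comp_mahalanobis β S).comp measurable_swap
  have hI : Integrable (fun x : Matrix (Fin k) (Fin q) ℝ × (Fin k → ℝ) =>
      ρ (mahalanobis x.swap β S)) (P.map Prod.swap) := by
    rw [integrable_map_measure hg.aestronglyMeasurable measurable_swap.aemeasurable]
    exact hR2.integrable_comp_mahalanobis β hS P
  have hmap : ∫ x, ρ (mahalanobis x.swap β S) ∂(P.map Prod.swap) =
      ∫ s, ρ (mahalanobis s β S) ∂P := by
    rw [integral_map measurable_swap.aemeasurable hg.aestronglyMeasurable]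
    simp
  rw [← hc] at hI hmap
  exact ⟨hI.integral_compProd, by rw [← hmap, Measure.integral_compProd hI]; rfl⟩
theorem mainTheorem2 {k q l : ℕ}
    (ρ : ℝ → ℝ) (hR1 : RhoR1 ρ) (hR2 : RhoR2 ρ)
    (V : (Fin l → ℝ) → Matrix (Fin k) (Fin k) ℝ) (hV : Identifiable V)
    (h : ℝ → ℝ) (h_nonneg : ∀ t, 0 ≤ t → 0 ≤ h t) (h_anti : AntitoneOn h (Set.Ici 0))
    (h_dens : IsProbabilityMeasure (ellipticalMeasure h (0 : Fin k → ℝ) 1))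
    (h_common : ∃ s, IsPointOfDecrease h s ∧ IsPointOfDecrease (fun t => -ρ (Real.sqrt t)) s)
    (b₀ : ℝ)
    (hb₀ : b₀ = ∫ z, ρ (Real.sqrt (z ⬝ᵥ z)) ∂(ellipticalMeasure h (0 : Fin k → ℝ) 1))
    (β₀ : Fin q → ℝ) (θ₀ : Fin l → ℝ) (hθ₀ : (V θ₀).PosDef) :
    -- conditionally on a design matrix `X` of full column rank
    (∀ X : Matrix (Fin k) (Fin q) ℝ, IsUnit (Xᵀ * X) →
      ∀ β θ, IsSSolution ρ b₀ V
          ((ellipticalMeasure h (X *ᵥ β₀) (V θ₀)).map fun y => (y, X)) β θ ↔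
        β = β₀ ∧ θ = θ₀) ∧
    -- for the joint distribution `P` of `(y, X)`
    (∀ (P : Measure ((Fin k → ℝ) × Matrix (Fin k) (Fin q) ℝ)) [IsProbabilityMeasure P],
      (∀ᵐ X ∂(P.map Prod.snd),
        condDistrib Prod.fst Prod.snd P X = ellipticalMeasure h (X *ᵥ β₀) (V θ₀)) →
      (∀ γ : Fin q → ℝ, (∀ᵐ s ∂P, s.2 *ᵥ γ = 0) → γ = 0) →
      ∀ β θ, IsSSolution ρ b₀ V P β θ ↔ β = β₀ ∧ θ = θ₀) := by

  have hmeas := hR2.exists_monotone.1.measurable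
  have hbase : ∀ μ : Fin k → ℝ,
      ∫ y, ρ (Real.sqrt (quadForm y μ (V θ₀))) ∂(ellipticalMeasure h μ (V θ₀)) = b₀ := fun μ => by
    rw [hb₀]
    exact integral_comp_quadForm_ellipticalMeasure h_anti hmeas hθ₀ μ
  have hlt : ∀ {θ} {μ μ₀ : Fin k → ℝ}, (V θ).PosDef → (V θ).det ≤ (V θ₀).det →
      ¬(μ = μ₀ ∧ V θ = V θ₀) →
      b₀ < ∫ y, ρ (Real.sqrt (quadForm y μ (V θ))) ∂(ellipticalMeasure h μ₀ (V θ₀)) :=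
    fun hθ hd hne => by
      rw [← hbase]
      exact integral_rho_lt hR2 h_nonneg h_anti h_dens h_common hθ hθ₀ hd hne
  have hge : ∀ {θ} {μ μ₀ : Fin k → ℝ}, (V θ).PosDef → (V θ).det ≤ (V θ₀).det →
      b₀ ≤ ∫ y, ρ (Real.sqrt (quadForm y μ (V θ))) ∂(ellipticalMeasure h μ₀ (V θ₀)) := by
    intro θ μ μ₀ hθ hd
    by_cases hne : μ = μ₀ ∧ V θ = V θ₀
    · rw [hne.1, hne.2, hbase]
    · exact (hlt hθ hd hne).le
  constructor
  · intro X hX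
    have hint : ∀ β θ, ∫ s, ρ (mahalanobis s β (V θ))
        ∂((ellipticalMeasure h (X *ᵥ β₀) (V θ₀)).map fun y => (y, X)) =
        ∫ y, ρ (Real.sqrt (quadForm y (X *ᵥ β) (V θ))) ∂(ellipticalMeasure h (X *ᵥ β₀) (V θ₀)) :=
      fun β θ => integral_map (by fun_prop)
        (hR2.measurable_comp_mahalanobis β (V θ)).aestronglyMeasurable
    refine isSSolution_iff_of_unique ⟨hθ₀, by rw [hint, hbase]⟩ fun β θ hf hd => ?_
    have hf2 := hf.2
    rw [hint] at hf2
    by_cases hne : X *ᵥ β = X *ᵥ β₀ ∧ V θ = V θ₀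
    · refine ⟨?_, hV θ θ₀ hf.1 hθ₀ hne.2⟩
      -- Multiplying `X *ᵥ β = X *ᵥ β₀` by `Xᵀ` reduces the claim to injectivity of `Xᵀ * X`.
      apply mulVec_injective_of_isUnit hX
      simp only [← mulVec_mulVec, hne.1]
    · exact absurd (hlt hf.1 hd hne) (not_lt.2 hf2)
  · intro P _ hP hγ
    have : IsProbabilityMeasure (P.map Prod.snd) :=
      Measure.isProbabilityMeasure_map measurable_snd.aemeasurable
    have hcond : ∀ β θ, ∀ᵐ X ∂(P.map Prod.snd),
        ∫ y, ρ (Real.sqrt (quadForm y (X *ᵥ β) (V θ))) ∂(condDistrib Prod.fst Prod.snd P X) =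
        ∫ y, ρ (Real.sqrt (quadForm y (X *ᵥ β) (V θ)))
          ∂(ellipticalMeasure h (X *ᵥ β₀) (V θ₀)) := fun β θ => by
      filter_upwards [hP] with X hX
      rw [hX]
    refine isSSolution_iff_of_unique ⟨hθ₀, ?_⟩ fun β θ hf hd => ?_
    · rw [(integral_mahalanobis_eq_integral_condDistrib hR2 β₀ hθ₀ P).2,
        integral_congr_ae (hcond β₀ θ₀)]
      simp [hbase]
    · obtain ⟨hI, he⟩ := integral_mahalanobis_eq_integral_condDistrib hR2 β hf.1 P
      have hI' := hI.congr (hcond β θ)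
      have hf2 := hf.2
      rw [he, integral_congr_ae (hcond β θ)] at hf2
      have hnn : 0 ≤ᵐ[P.map Prod.snd] fun X => (∫ y, ρ (Real.sqrt (quadForm y (X *ᵥ β) (V θ)))
          ∂(ellipticalMeasure h (X *ᵥ β₀) (V θ₀))) - b₀ :=
        Filter.Eventually.of_forall fun X => sub_nonneg.2 (hge hf.1 hd)
      have hI'' := hI'.sub (integrable_const b₀)
      -- Each conditional loss is at least `b₀`, while feasibility bounds their average by `b₀`;
      -- hence they equal `b₀` for almost every `X`.
      have hz : ∫ X, ((∫ y, ρ (Real.sqrt (quadForm y (X *ᵥ β) (V θ)))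
          ∂(ellipticalMeasure h (X *ᵥ β₀) (V θ₀))) - b₀) ∂(P.map Prod.snd) = 0 := by
        refine le_antisymm ?_ (integral_nonneg_of_ae hnn)
        rw [integral_sub hI' (integrable_const b₀)]
        simpa using hf2
      have hae : ∀ᵐ X ∂(P.map Prod.snd), X *ᵥ β = X *ᵥ β₀ ∧ V θ = V θ₀ := by
        filter_upwards [(integral_eq_zero_iff_of_nonneg_ae hnn hI'').1 hz] with X hX
        by_contra hne
        have := hlt hf.1 hd hne
        simp only [Pi.zero_apply] at hX
        linarith
      -- `V θ = V θ₀` does not involve `X`, so a single `X` from the almost sure set gives it.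
      obtain ⟨-, -, hVθ⟩ := hae.exists
      refine ⟨sub_eq_zero.1 (hγ (β - β₀) ?_), hV θ θ₀ hf.1 hθ₀ hVθ⟩
      filter_upwards [ae_of_ae_map measurable_snd.aemeasurable hae] with s hs
      rw [mulVec_sub, hs.1, sub_self]
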